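/- Let $\mu,\nu$ be Borel probability measures on $\mathbb{R}^d$. Let $$W_2(\mu,\nu)=\Big(\inf_\gamma\int_{\mathbb{R}^d\times\mathbb{R}^d}|x-y|^2\,d\gamma(x,y)\Big)^{1/2}\in[0,+\infty],$$ where the infimum is over all probability measures $\gamma$ on $\mathbb{R}^d\times\mathbb{R}^d$ with first marginal $\mu$ and second marginal $\nu$, and let $\chi_2(\nu|\mu)=\left\|\frac{d\nu}{d\mu}-1\right\|_{L^2(\mu)}\in[0,+\infty]$ if $\nu$ is absolutely continuous with respect to $\mu$, and $\chi_2(\nu|\mu)=+\infty$ otherwise. For a constant $C\ge 0$, we say that $\mu$ satisfies - the transport-chi-square inequality $\mathcal{T}_\chi(C)$ if $W_2(\mu,\nu)\le\sqrt{C}\,\chi_2(\nu|\mu)$ for every probability measure $\nu$ on $\mathbb{R}^d$ (no condition being imposed when $\chi_2(\nu|\mu)=+\infty$); - the Poincaré inequality $\mathcal{P}(C)$ if every $C^1$ function $\varphi:\mathbb{R}^d\to\mathbb{R}$ with bounded gradient is square-integrable with respect to $\mu$ and satisfies $$\int\varphi^2\,d\mu-\Big(\int\varphi\,d\mu\Big)^2\le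 C\int|\nabla\varphi|^2\,d\mu.$$ **Theorem 1.** For every $d\ge 1$, every probability measure $\mu$ on $\mathbb{R}^d$ and every $C\ge 0$, if $\mu$ satisfies $\mathcal{T}_\chi(C)$, then $\mu$ satisfies $\mathcal{P}(C)$. Moreover, when $d=1$, if $\mu$ satisfies $\mathcal{P}(C)$, then $\mu$ satisfies $\mathcal{T}_\chi(32C)$. Hence on $\mathbb{R}$ the two inequalities are equivalent: $\mu$ satisfies $\mathcal{T}_\chi(C)$ for some $C\ge 0$ if and only if it satisfies $\mathcal{P}(C)$ for some $C\ge 0$. -/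

import Mathlib

open MeasureTheory
open scoped ENNReal Gradient

/-- The couplings of `μ` and `ν`: probability measures on the product space with first marginal `μ`
and second marginal `ν`. -/
def couplings {E : Type*} [MeasurableSpace E] (μ ν : Measure E) : Set (Measure (E × E)) :=
  {γ | IsProbabilityMeasure γ ∧ γ.map Prod.fst = μ ∧ γ.map Prod.snd = ν}

/-- The quadratic Wasserstein distance `W₂(μ, ν) ∈ [0, ∞]`, the square root of the infimum of
`∫ |x - y|² dγ(x, y)` over all couplings `γ` of `μ` and `ν`. -/
noncomputable def wasserstein₂ {E : Type*} [NormedAddCommGroup E] [MeasurableSpace E]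
    (μ ν : Measure E) : ℝ≥0∞ :=
  (⨅ γ ∈ couplings μ ν, ∫⁻ p, ‖p.1 - p.2‖ₑ ^ 2 ∂γ) ^ (1 / 2 : ℝ)

open Classical in
/-- The square `χ₂²(ν|μ) ∈ [0, ∞]` of the chi-square pseudo-distance: `∫ (dν/dμ - 1)² dμ` if `ν` is
absolutely continuous with respect to `μ`, and `∞` otherwise. -/
noncomputable def chiSquareSq {E : Type*} [MeasurableSpace E] (ν μ : Measure E) : ℝ≥0∞ :=
  if ν ≪ μ then ∫⁻ x, ENNReal.ofReal (((ν.rnDeriv μ x).toReal - 1) ^ 2) ∂μ else ∞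

/-- The chi-square pseudo-distance `χ₂(ν|μ) ∈ [0, ∞]`. -/
noncomputable def chiSquare {E : Type*} [MeasurableSpace E] (ν μ : Measure E) : ℝ≥0∞ :=
  chiSquareSq ν μ ^ (1 / 2 : ℝ)

/-- The Poincaré inequality `P(C)`: the variance under `μ` of every `C¹` function `φ` with bounded
gradient is finite and at most `C ∫ |∇φ|² dμ`. The clause `MemLp φ 2 μ` (that is, `∫ φ² dμ < ∞`) is
the part of the inequality that real-valued integrals do not express: their value is `0` for a
function that is not integrable. -/
def PoincareInequality {E : Type*} [NormedAddCommGroup E] [InnerProductSpace ℝ E] [CompleteSpace E]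
    [MeasurableSpace E] (μ : Measure E) (C : ℝ) : Prop :=
  ∀ φ : E → ℝ, ContDiff ℝ 1 φ → (∃ K : ℝ, ∀ x, ‖∇ φ x‖ ≤ K) →
    MemLp φ 2 μ ∧
      ∫ x, φ x ^ 2 ∂μ - (∫ x, φ x ∂μ) ^ 2 ≤ C * ∫ x, ‖∇ φ x‖ ^ 2 ∂μ

/-- The transport-chi-square inequality `T_χ(C)` for a constant `C ≥ 0`:
`W₂(μ, ν) ≤ √C χ₂(ν|μ)` for every probability measure `ν`. The inequality is void when
`χ₂(ν|μ) = ∞`; this is written out because `0 * ∞ = 0` in `[0, ∞]` (it matters for `C = 0` only). -/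
def TransportChiSquareInequality {E : Type*} [NormedAddCommGroup E] [MeasurableSpace E]
    (μ : Measure E) (C : ℝ) : Prop :=
  ∀ ν : Measure E, IsProbabilityMeasure ν → chiSquare ν μ ≠ ∞ →
    wasserstein₂ μ ν ≤ ENNReal.ofReal (√C) * chiSquare ν μ

/-! From transport to Poincaré, linearize at `ν = (1 + εf)μ` with `f` bounded and of `μ`-mean zero.
Then `χ₂² = ε² ∫ f² dμ`, while `ε ∫ φ f dμ = ∫ φ dν - ∫ φ dμ` is, along a nearly optimal coupling,
at most the integral of `|∇φ(x)| |x - y|` up to small errors. Cauchy–Schwarz and `ε → 0` bound `∫ φ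
f dμ` by `√(∫ |∇φ|² dμ) √(C ∫ f² dμ)` (`TransportChiSquareInequality.integral_mul_le`). Centred
truncations of `φ` serve as `f`; in the limit `Var φ ≤ √(∫ |∇φ|² dμ) √(C Var φ)`.

From Poincaré to transport on the line, couple by quantile functions `q_μ(u)`, `q_ν(u)`, let `T` be
the monotone map `q_ν ∘ cdf μ`, and test with the primitive `φ` of `ψ(x) = T(x) - x`. Monotonicity
of `T` makes `ψ(x) ≥ q_ν(u) - x` for `q_μ(u) ≤ x ≤ q_ν(u)`, and symmetrically in the other order, so
`φ(q_ν(u)) - φ(q_μ(u))` is at least half the squared distance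
(`sq_min_div_two_le_integral_truncatedDisplacement`). With `I` the cost of the coupling, `I / 2 ≤ ∫
φ dν - ∫ φ dμ ≤ √(Var φ) χ₂ ≤ √(C I) χ₂`, hence `I ≤ 4 C χ₂²`. Truncating `ψ` at level `R` makes `φ`
Lipschitz and `I` finite. Setting `ψ = 0` at the atoms of `μ` leaves `φ` unchanged and secures `∫ ψ²
dμ ≤ I`. -/

open Filter Topology ProbabilityTheory

/-! ### Square-integrable functions -/

section Preliminaries

variable {α : Type*} [MeasurableSpace α] {μ : Measure α}

/-- The Cauchy–Schwarz inequality for real square-integrable functions. -/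
theorem integral_mul_le_sqrt_mul_sqrt {f g : α → ℝ} (hf : MemLp f 2 μ) (hg : MemLp g 2 μ) :
    ∫ x, f x * g x ∂μ ≤ √(∫ x, f x ^ 2 ∂μ) * √(∫ x, g x ^ 2 ∂μ) := by
  have h := integral_mul_le_Lp_mul_Lq_of_nonneg (μ := μ) (p := 2) (q := 2) (f := fun x => |f x|)
    (g := fun x => |g x|) Real.HolderConjugate.two_two
    (Eventually.of_forall fun x => abs_nonneg _) (Eventually.of_forall fun x => abs_nonneg _)
    (by rw [ENNReal.ofReal_ofNat]; exact hf.abs) (by rw [ENNReal.ofReal_ofNat]; exact hg.abs)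
  simp only [Real.rpow_two, sq_abs, ← Real.sqrt_eq_rpow] at h
  refine le_trans (integral_mono (hf.integrable_mul hg) (hf.abs.integrable_mul hg.abs) ?_) h
  intro x
  simpa [abs_mul] using le_abs_self (f x * g x)

theorem toReal_lintegral_enorm_sq {E : Type*} [NormedAddCommGroup E] {f : α → E}
    (hf : AEStronglyMeasurable f μ) :
    (∫⁻ x, ‖f x‖ₑ ^ 2 ∂μ).toReal = ∫ x, ‖f x‖ ^ 2 ∂μ := by
  have hm : AEStronglyMeasurable (fun x => ‖f x‖ ^ 2) μ := hf.norm.pow 2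
  rw [integral_eq_lintegral_of_nonneg_ae (Eventually.of_forall fun x => by positivity) hm]
  congr 2 with x
  rw [← ofReal_norm, ENNReal.ofReal_pow (norm_nonneg _)]

theorem memLp_two_of_lintegral_enorm_sq_ne_top {E : Type*} [NormedAddCommGroup E] {f : α → E}
    (hf : AEStronglyMeasurable f μ) (h : ∫⁻ x, ‖f x‖ₑ ^ 2 ∂μ ≠ ∞) : MemLp f 2 μ := by
  refine ⟨hf, ?_⟩
  rw [eLpNorm_lt_top_iff_lintegral_rpow_enorm_lt_top (by simp) (by simp)]
  simpa [lt_top_iff_ne_top] using h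

/-- The variance of a square-integrable function as the integral of a product. -/
theorem integral_sub_const_sq [IsProbabilityMeasure μ] {f : α → ℝ} (hf : MemLp f 2 μ) :
    ∫ x, (f x - ∫ y, f y ∂μ) ^ 2 ∂μ = ∫ x, f x ^ 2 ∂μ - (∫ x, f x ∂μ) ^ 2 := by
  have h1 : Integrable f μ := hf.integrable (by norm_num)
  have h2 := hf.integrable_sq
  set m := ∫ y, f y ∂μ with hm
  have : (fun x => (f x - m) ^ 2) = fun x => (f x ^ 2 - 2 * m * f x) + m ^ 2 := by
    ext x; ring
  have h3 : Integrable (fun x => f x ^ 2 - 2 * m * f x) μ := h2.sub (h1.const_mul _)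
  rw [this, integral_add h3 (integrable_const _), integral_sub h2 (h1.const_mul _), integral_const_mul, ← hm]
  simp
  ring

end Preliminaries

/-! ### Chi-square pseudo-distance of a density -/

section ChiSquare

variable {E : Type*} [MeasurableSpace E] {μ : Measure E}

theorem isProbabilityMeasure_withDensity_ofReal {g : E → ℝ} (hg0 : ∀ x, 0 ≤ g x)
    (hgi : Integrable g μ) (hg1 : ∫ x, g x ∂μ = 1) :
    IsProbabilityMeasure (μ.withDensity fun x => ENNReal.ofReal (g x)) := by
  constructor
  rw [withDensity_apply _ MeasurableSet.univ, Measure.restrict_univ,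
    ← ofReal_integral_eq_lintegral_ofReal hgi (Eventually.of_forall hg0), hg1, ENNReal.ofReal_one]

theorem chiSquareSq_withDensity [SigmaFinite μ] {g : E → ℝ} (hg : Measurable g)
    (hg0 : ∀ x, 0 ≤ g x) :
    chiSquareSq (μ.withDensity fun x => ENNReal.ofReal (g x)) μ
      = ∫⁻ x, ENNReal.ofReal ((g x - 1) ^ 2) ∂μ := by
  rw [chiSquareSq, if_pos (withDensity_absolutelyContinuous _ _)]
  refine lintegral_congr_ae ?_
  filter_upwards [Measure.rnDeriv_withDensity μ hg.ennreal_ofReal] with x hx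
  rw [hx, ENNReal.toReal_ofReal (hg0 x)]

theorem chiSquare_ne_top_iff {ν : Measure E} : chiSquare ν μ ≠ ∞ ↔ chiSquareSq ν μ ≠ ∞ := by
  simp [chiSquare]

end ChiSquare

/-- Under a transport-chi-square inequality there are couplings of cost arbitrarily close to
`C χ₂²(ν|μ)`. -/
theorem TransportChiSquareInequality.exists_coupling {E : Type*} [NormedAddCommGroup E]
    [MeasurableSpace E] {μ : Measure E} {C : ℝ} (hC : 0 ≤ C)
    (h : TransportChiSquareInequality μ C) (ν : Measure E) [IsProbabilityMeasure ν]
    (hχ : chiSquareSq ν μ ≠ ∞) {η : ℝ≥0∞} (hη : η ≠ 0) :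
    ∃ γ ∈ couplings μ ν, ∫⁻ p, ‖p.1 - p.2‖ₑ ^ 2 ∂γ ≤ ENNReal.ofReal C * chiSquareSq ν μ + η := by
  have h1 := h ν inferInstance (chiSquare_ne_top_iff.2 hχ)
  have h2 : (⨅ γ ∈ couplings μ ν, ∫⁻ p, ‖p.1 - p.2‖ₑ ^ 2 ∂γ)
      ≤ ENNReal.ofReal C * chiSquareSq ν μ := by
    have h3 := ENNReal.rpow_le_rpow h1 (by norm_num : (0 : ℝ) ≤ 2)
    rw [wasserstein₂, chiSquare, ENNReal.mul_rpow_of_nonneg _ _ (by norm_num), ← ENNReal.rpow_mul,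
      ← ENNReal.rpow_mul, ENNReal.ofReal_rpow_of_nonneg (Real.sqrt_nonneg _) (by norm_num)] at h3
    simpa [Real.sq_sqrt hC] using h3
  have h4 : (⨅ γ ∈ couplings μ ν, ∫⁻ p, ‖p.1 - p.2‖ₑ ^ 2 ∂γ)
      < ENNReal.ofReal C * chiSquareSq ν μ + η :=
    h2.trans_lt (ENNReal.lt_add_right (ENNReal.mul_ne_top ENNReal.ofReal_ne_top hχ) hη)
  simp only [iInf_lt_iff] at h4
  obtain ⟨γ, hγ, hlt⟩ := h4
  exact ⟨γ, hγ, hlt.le⟩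

/-! ### From transport to Poincaré by linearization -/

section Linearization

variable {E : Type*} [NormedAddCommGroup E] [InnerProductSpace ℝ E] [FiniteDimensional ℝ E]
  [MeasurableSpace E] [BorelSpace E] {μ : Measure E} {C : ℝ}

/-- A probability measure satisfying a transport-chi-square inequality has a finite second
moment. -/
theorem TransportChiSquareInequality.memLp_id [IsProbabilityMeasure μ] (hC : 0 ≤ C)
    (h : TransportChiSquareInequality μ C) : MemLp (fun x : E => x) 2 μ := by
  obtain ⟨n, hn⟩ : ∃ n : ℕ, 0 < μ (Metric.ball (0 : E) n) := by
    by_contra! hcon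
    have : μ (⋃ n : ℕ, Metric.ball (0 : E) n) = 0 :=
      measure_iUnion_null fun n => le_antisymm (hcon n) bot_le
    rw [Metric.iUnion_ball_nat] at this
    simp at this
  set B := Metric.ball (0 : E) n with hB
  have hBm : MeasurableSet B := measurableSet_ball
  have hpos : 0 < μ.real B := ENNReal.toReal_pos hn.ne' (measure_ne_top _ _)
  -- The test measure is `μ` conditioned on a ball of positive mass. Its density is bounded, so `χ₂`
  -- is finite, and it is concentrated on the ball, so a coupling of finite cost carries its second
  -- moment back to `μ`.
  set g : E → ℝ := B.indicator fun _ => (μ.real B)⁻¹ with hg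
  have hgm : Measurable g := measurable_const.indicator hBm
  have hg0 : ∀ x, 0 ≤ g x := fun x => Set.indicator_nonneg (fun _ _ => by positivity) x
  have hgi : Integrable g μ := (integrable_const _).indicator hBm
  have hg1 : ∫ x, g x ∂μ = 1 := by
    rw [hg, integral_indicator hBm]
    simp [hpos.ne']
  have hprob := isProbabilityMeasure_withDensity_ofReal hg0 hgi hg1
  set ν := μ.withDensity fun x => ENNReal.ofReal (g x) with hν
  have hχ : chiSquareSq ν μ ≠ ∞ := by
    rw [hν, chiSquareSq_withDensity hgm hg0]
    have hle : ∀ x, (g x - 1) ^ 2 ≤ ((μ.real B)⁻¹ + 1) ^ 2 := by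
      intro x
      have : g x ≤ (μ.real B)⁻¹ := Set.indicator_le_self' (fun _ _ => by positivity) x
      have := hg0 x
      apply sq_le_sq'
      · linarith
      · linarith
    refine ne_top_of_le_ne_top ?_ (lintegral_mono fun x => ENNReal.ofReal_le_ofReal (hle x))
    simp
  obtain ⟨γ, ⟨hγp, hγ1, hγ2⟩, hcost⟩ := h.exists_coupling hC ν hχ one_ne_zero
  have hcost' : ∫⁻ p : E × E, ‖p.1 - p.2‖ₑ ^ 2 ∂γ ≠ ∞ :=
    ne_top_of_le_ne_top (by finiteness) hcost
  have hd : MemLp (fun p : E × E => p.1 - p.2) 2 γ :=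
    memLp_two_of_lintegral_enorm_sq_ne_top (by fun_prop) hcost'
  have hνB : ∀ᵐ y ∂ν, ‖y‖ ≤ n := by
    rw [hν, ae_withDensity_iff (by fun_prop)]
    refine Eventually.of_forall fun x hx => ?_
    by_contra! hlt
    refine hx ?_
    have : x ∉ B := by simp [hB, hlt.le]
    simp [hg, this]
  have hsnd : MemLp (fun p : E × E => p.2) 2 γ := by
    refine MemLp.of_bound (by fun_prop) n ?_
    rw [← hγ2] at hνB
    exact ae_of_ae_map measurable_snd.aemeasurable hνB
  have hfst : MemLp (fun p : E × E => p.1) 2 γ := by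
    have := hd.add hsnd
    refine this.congr_norm (by fun_prop) (Eventually.of_forall fun p => by simp)
  rw [← hγ1]
  exact (memLp_map_measure_iff (by fun_prop) (by fun_prop)).2 hfst

variable [CompleteSpace E]

omit [MeasurableSpace E] [BorelSpace E] in
/-- First order expansion of a `C¹` function with bounded gradient: the increments are controlled by
the gradient at the first point, up to a small error, a bounded error far from the origin, and a
quadratic error. -/
theorem exists_abs_sub_le_gradient {φ : E → ℝ} (hφ : ContDiff ℝ 1 φ) {K : ℝ}
    (hK : ∀ x, ‖∇ φ x‖ ≤ K) {η : ℝ} (hη : 0 < η) (R : ℝ) :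
    ∃ M : ℝ, ∀ x y, |φ x - φ y| ≤
      (‖∇ φ x‖ + (η + (Metric.closedBall (0 : E) R)ᶜ.indicator (fun _ => 2 * K) x)) * ‖x - y‖
        + M * ‖x - y‖ ^ 2 := by
  have hnorm : ∀ x, ‖fderiv ℝ φ x‖ = ‖∇ φ x‖ := fun x => by simp [gradient]
  have hK0 : 0 ≤ K := (norm_nonneg _).trans (hK 0)
  have hcont : Continuous (fderiv ℝ φ) := hφ.continuous_fderiv one_ne_zero
  have hdiff : Differentiable ℝ φ := hφ.differentiable one_ne_zero
  -- One `δ` serves all `x` in the compact ball and all `y` within `δ` of `x`, whether or not `y`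
  -- lies in the ball.
  have hu := (isCompact_closedBall (0 : E) R).uniformContinuousAt_of_continuousAt
    (fderiv ℝ φ) (fun a _ => hcont.continuousAt) (Metric.dist_mem_uniformity hη)
  obtain ⟨δ, hδ, hδu⟩ := Metric.mem_uniformity_dist.1 hu
  have hind : ∀ x, 0 ≤ (Metric.closedBall (0 : E) R)ᶜ.indicator (fun _ => 2 * K) x := fun x =>
    Set.indicator_nonneg (fun _ _ => by positivity) x
  have hlip : ∀ x y, |φ x - φ y| ≤ K * ‖x - y‖ := by
    intro x y
    have := convex_univ.norm_image_sub_le_of_norm_fderiv_le (𝕜 := ℝ) (f := φ) (C := K)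
      (fun z _ => hdiff z) (fun z _ => (hnorm z).trans_le (hK z)) (Set.mem_univ y) (Set.mem_univ x)
    simpa using this
  -- For `‖x - y‖ ≥ δ` the Lipschitz bound `K ‖x - y‖` is at most `(K / δ) ‖x - y‖ ^ 2`.
  refine ⟨K / δ, fun x y => ?_⟩
  have hM : 0 ≤ K / δ * ‖x - y‖ ^ 2 := by positivity
  by_cases hx : x ∈ Metric.closedBall (0 : E) R
  · rcases lt_or_ge ‖x - y‖ δ with hxy | hxy
    · have key : ‖φ y - φ x - fderiv ℝ φ x (y - x)‖ ≤ η * ‖y - x‖ := by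
        refine Convex.norm_image_sub_le_of_norm_hasFDerivWithin_le' (s := Metric.ball x δ)
          (f' := fderiv ℝ φ) (fun z _ => (hdiff z).hasFDerivAt.hasFDerivWithinAt) (fun z hz => ?_)
          (convex_ball _ _) (Metric.mem_ball_self hδ) ?_
        · have h3 := hδu (a := x) (b := z) (by rw [dist_comm]; exact hz) hx
          have h4 : dist (fderiv ℝ φ x) (fderiv ℝ φ z) < η := h3
          rw [← dist_eq_norm, dist_comm]
          exact h4.le
        · rw [Metric.mem_ball, dist_eq_norm, norm_sub_rev]; exact hxy
      have h2 : ‖fderiv ℝ φ x (y - x)‖ ≤ ‖∇ φ x‖ * ‖y - x‖ := by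
        rw [← hnorm]; exact (fderiv ℝ φ x).le_opNorm _
      have h3 : |φ x - φ y| ≤ ‖φ y - φ x - fderiv ℝ φ x (y - x)‖ + ‖fderiv ℝ φ x (y - x)‖ := by
        rw [abs_sub_comm, ← Real.norm_eq_abs]
        exact norm_le_norm_sub_add _ _
      rw [norm_sub_rev y x] at *
      nlinarith [mul_nonneg (hind x) (norm_nonneg (x - y))]
    · have h1 : K * ‖x - y‖ ≤ K / δ * ‖x - y‖ ^ 2 := by
        rw [div_mul_eq_mul_div, le_div_iff₀ hδ, sq]
        nlinarith [mul_le_mul_of_nonneg_left hxy (mul_nonneg hK0 (norm_nonneg (x - y)))]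
      have h2 := hlip x y
      have : 0 ≤ (‖∇ φ x‖ + (η + (Metric.closedBall (0 : E) R)ᶜ.indicator (fun _ => 2 * K) x))
          * ‖x - y‖ := by
        have := hind x
        positivity
      linarith
  -- Outside the ball the indicator term alone dominates the Lipschitz constant `K`.
  · have : (Metric.closedBall (0 : E) R)ᶜ.indicator (fun _ => 2 * K) x = 2 * K :=
      Set.indicator_of_mem hx _
    rw [this]
    have h2 := hlip x y
    nlinarith [norm_nonneg (∇ φ x), norm_nonneg (x - y), mul_nonneg (norm_nonneg (∇ φ x))
      (norm_nonneg (x - y)), mul_nonneg hη.le (norm_nonneg (x - y)), mul_nonneg hK0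
      (norm_nonneg (x - y))]

omit [FiniteDimensional ℝ E] in
theorem memLp_two_of_gradient_bounded [IsProbabilityMeasure μ] (hid : MemLp (fun x : E => x) 2 μ)
    {φ : E → ℝ} (hφ : ContDiff ℝ 1 φ) {K : ℝ} (hK : ∀ x, ‖∇ φ x‖ ≤ K) : MemLp φ 2 μ := by
  have hlip : ∀ x, |φ x - φ 0| ≤ K * ‖x‖ := by
    intro x
    have := convex_univ.norm_image_sub_le_of_norm_fderiv_le (𝕜 := ℝ) (f := φ) (C := K)
      (fun z _ => hφ.differentiable one_ne_zero z)
      (fun z _ => by simpa [gradient] using hK z) (Set.mem_univ 0) (Set.mem_univ x)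
    simpa using this
  refine MemLp.mono' (g := fun x => K * ‖x‖ + |φ 0|) ?_
    hφ.continuous.aestronglyMeasurable (Eventually.of_forall fun x => ?_)
  · exact (hid.norm.const_mul K).add (memLp_const _)
  · have := abs_sub_abs_le_abs_sub (φ x) (φ 0)
    have := hlip x
    rw [Real.norm_eq_abs]
    linarith

/-- Linearization of the transport-chi-square inequality along the perturbations `(1 + ε f) μ`. -/
theorem TransportChiSquareInequality.integral_mul_le [IsProbabilityMeasure μ] (hC : 0 ≤ C)
    (h : TransportChiSquareInequality μ C) {φ : E → ℝ} (hφ : ContDiff ℝ 1 φ) {K : ℝ}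
    (hK : ∀ x, ‖∇ φ x‖ ≤ K) {f : E → ℝ} (hf : Measurable f) {L : ℝ} (hL : ∀ x, |f x| ≤ L)
    (hf0 : ∫ x, f x ∂μ = 0) :
    ∫ x, φ x * f x ∂μ ≤ √(∫ x, ‖∇ φ x‖ ^ 2 ∂μ) * √(C * ∫ x, f x ^ 2 ∂μ) := by
  have hid := h.memLp_id hC
  have hφ2 := memLp_two_of_gradient_bounded hid hφ hK
  have hφ1 : Integrable φ μ := hφ2.integrable (by norm_num)
  have hf2 : MemLp f 2 μ := MemLp.of_bound hf.aestronglyMeasurable L (Eventually.of_forall hL)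
  have hfi : Integrable f μ := hf2.integrable (by norm_num)
  have hφf : Integrable (fun x => φ x * f x) μ := hφ2.integrable_mul hf2
  have hgm : Measurable (∇ φ) := by
    have : Continuous (∇ φ) := by
      unfold gradient
      exact (LinearIsometryEquiv.continuous _).comp (hφ.continuous_fderiv one_ne_zero)
    exact this.measurable
  have hL0 : 0 ≤ L := (abs_nonneg _).trans (hL 0)
  set V := ∫ x, f x ^ 2 ∂μ with hV
  -- the increment of `φ` along a good coupling of `μ` and `(1 + ε f) μ`
  have step : ∀ (H : E → ℝ), MemLp H 2 μ → ∀ M : ℝ, 0 ≤ M →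
      (∀ x y, |φ x - φ y| ≤ H x * ‖x - y‖ + M * ‖x - y‖ ^ 2) → ∀ ε : ℝ, 0 < ε → ε * L ≤ 1 →
      ∫ x, φ x * f x ∂μ ≤ √(∫ x, H x ^ 2 ∂μ) * √(C * V + ε) + M * (ε * (C * V + ε)) := by
    intro H hH M hM0 hM ε hε hεL
    set g : E → ℝ := fun x => 1 + ε * f x with hg
    have hgm : Measurable g := by fun_prop
    have hg0 : ∀ x, 0 ≤ g x := fun x => by
      have := neg_le_of_abs_le (hL x)
      simp only [hg]
      nlinarith
    have hgi : Integrable g μ := (integrable_const _).add (hfi.const_mul _)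
    have hg1 : ∫ x, g x ∂μ = 1 := by
      rw [hg, integral_add (integrable_const _) (hfi.const_mul _), integral_const_mul, hf0]
      simp
    have hprob := isProbabilityMeasure_withDensity_ofReal hg0 hgi hg1
    have hχ : chiSquareSq (μ.withDensity fun x => ENNReal.ofReal (g x)) μ
        = ENNReal.ofReal (ε ^ 2 * V) := by
      rw [chiSquareSq_withDensity hgm hg0, hV, ← integral_const_mul,
        ofReal_integral_eq_lintegral_ofReal (hf2.integrable_sq.const_mul _)
          (Eventually.of_forall fun x => by positivity)]
      congr 1 with x
      simp only [hg]; ring_nf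
    have hφν : ∫ x, φ x ∂(μ.withDensity fun x => ENNReal.ofReal (g x))
        = ∫ x, φ x ∂μ + ε * ∫ x, φ x * f x ∂μ := by
      rw [integral_withDensity_eq_integral_toReal_smul (by fun_prop) (by simp),
        ← integral_const_mul, ← integral_add hφ1 (hφf.const_mul _)]
      congr 1 with x
      rw [ENNReal.toReal_ofReal (hg0 x), smul_eq_mul, hg]
      ring
    have hφνi : Integrable φ (μ.withDensity fun x => ENNReal.ofReal (g x)) := by
      rw [integrable_withDensity_iff (by fun_prop) (by simp)]
      refine (hφ1.add (hφf.const_mul ε)).congr (Eventually.of_forall fun x => ?_)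
      simp only [Pi.add_apply]
      rw [ENNReal.toReal_ofReal (hg0 x), hg]
      ring
    generalize (μ.withDensity fun x => ENNReal.ofReal (g x)) = ν at *
    -- The slack `ε ^ 3` is of lower order than `χ₂² = ε ^ 2 * V`, so it disappears after division
    -- by `ε ^ 2`.
    obtain ⟨γ, ⟨hγp, hγ1, hγ2⟩, hcost⟩ := h.exists_coupling hC ν (by simp [hχ])
      (η := ENNReal.ofReal (ε ^ 3)) (by simp [hε])
    have hV0 : 0 ≤ V := integral_nonneg fun x => sq_nonneg _
    rw [hχ, ← ENNReal.ofReal_mul hC, ← ENNReal.ofReal_add (by positivity) (by positivity)] at hcost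
    have hd : MemLp (fun p : E × E => p.1 - p.2) 2 γ :=
      memLp_two_of_lintegral_enorm_sq_ne_top (by fun_prop)
        (ne_top_of_le_ne_top ENNReal.ofReal_ne_top hcost)
    have hW : ∫ p : E × E, ‖p.1 - p.2‖ ^ 2 ∂γ ≤ ε ^ 2 * (C * V + ε) := by
      rw [← toReal_lintegral_enorm_sq (by fun_prop)]
      refine ENNReal.toReal_le_of_le_ofReal (by positivity) (hcost.trans_eq ?_)
      congr 1; ring
    have hHγ : MemLp (fun p : E × E => H p.1) 2 γ := by
      rw [← hγ1] at hH
      exact hH.comp_of_map measurable_fst.aemeasurable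
    have hφ1γ : Integrable (fun p : E × E => φ p.1) γ := by
      rw [← hγ1] at hφ1
      exact hφ1.comp_measurable measurable_fst
    have hφ2γ : Integrable (fun p : E × E => φ p.2) γ := by
      rw [← hγ2] at hφνi
      exact hφνi.comp_measurable measurable_snd
    have hHd : Integrable (fun p : E × E => H p.1 * ‖p.1 - p.2‖) γ := hHγ.integrable_mul hd.norm
    have hd2 : Integrable (fun p : E × E => ‖p.1 - p.2‖ ^ 2) γ := hd.norm.integrable_sq
    have e1 : ∫ p : E × E, φ p.1 ∂γ = ∫ x, φ x ∂μ := by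
      rw [← hγ1, integral_map (by fun_prop) hφ.continuous.aestronglyMeasurable]
    have e2 : ∫ p : E × E, φ p.2 ∂γ = ∫ x, φ x ∂ν := by
      rw [← hγ2, integral_map (by fun_prop) hφ.continuous.aestronglyMeasurable]
    have e3 : ∫ p : E × E, H p.1 ^ 2 ∂γ = ∫ x, H x ^ 2 ∂μ := by
      rw [← hγ1] at hH ⊢
      have hm : AEStronglyMeasurable (fun x => H x ^ 2) (γ.map Prod.fst) := hH.1.pow 2
      rw [integral_map (by fun_prop) hm]
    have i1 : ε * ∫ x, φ x * f x ∂μ = ∫ p : E × E, (φ p.2 - φ p.1) ∂γ := by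
      rw [integral_sub hφ2γ hφ1γ, e1, e2, hφν]; ring
    have i2 : ∫ p : E × E, (φ p.2 - φ p.1) ∂γ
        ≤ ∫ p : E × E, (H p.1 * ‖p.1 - p.2‖ + M * ‖p.1 - p.2‖ ^ 2) ∂γ := by
      refine integral_mono (hφ2γ.sub hφ1γ) (hHd.add (hd2.const_mul M)) fun p => ?_
      refine le_trans ?_ (hM p.1 p.2)
      rw [abs_sub_comm]
      exact le_abs_self _
    rw [integral_add hHd (hd2.const_mul M), integral_const_mul] at i2
    have i3 := integral_mul_le_sqrt_mul_sqrt hHγ hd.norm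
    rw [e3] at i3
    have i4 : √(∫ p : E × E, ‖p.1 - p.2‖ ^ 2 ∂γ) ≤ ε * √(C * V + ε) := by
      refine (Real.sqrt_le_sqrt hW).trans_eq ?_
      rw [Real.sqrt_mul (by positivity), Real.sqrt_sq hε.le]
    have i5 : ε * ∫ x, φ x * f x ∂μ
        ≤ ε * (√(∫ x, H x ^ 2 ∂μ) * √(C * V + ε) + M * (ε * (C * V + ε))) := by
      have j1 := mul_le_mul_of_nonneg_left i4 (Real.sqrt_nonneg (∫ x, H x ^ 2 ∂μ))
      have j2 := mul_le_mul_of_nonneg_left hW hM0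
      rw [i1]
      calc _ ≤ _ := i2
        _ ≤ √(∫ x, H x ^ 2 ∂μ) * (ε * √(C * V + ε)) + M * (ε ^ 2 * (C * V + ε)) :=
          add_le_add (i3.trans j1) j2
        _ = _ := by ring
    exact le_of_mul_le_mul_left i5 hε
  have step2 : ∀ (H : E → ℝ), MemLp H 2 μ → ∀ M : ℝ,
      (∀ x y, |φ x - φ y| ≤ H x * ‖x - y‖ + M * ‖x - y‖ ^ 2) →
      ∫ x, φ x * f x ∂μ ≤ √(∫ x, H x ^ 2 ∂μ) * √(C * V) := by
    intro H hH M hM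
    have hM' : ∀ x y, |φ x - φ y| ≤ H x * ‖x - y‖ + |M| * ‖x - y‖ ^ 2 := fun x y =>
      (hM x y).trans (by gcongr; exact le_abs_self M)
    have ht : Tendsto (fun ε : ℝ => √(∫ x, H x ^ 2 ∂μ) * √(C * V + ε) + |M| * (ε * (C * V + ε)))
        (𝓝[>] 0) (𝓝 (√(∫ x, H x ^ 2 ∂μ) * √(C * V + 0) + |M| * (0 * (C * V + 0)))) := by
      refine tendsto_nhdsWithin_of_tendsto_nhds (Continuous.tendsto ?_ 0)
      fun_prop
    rw [add_zero, zero_mul, mul_zero, add_zero] at ht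
    refine ge_of_tendsto ht ?_
    filter_upwards [self_mem_nhdsWithin, nhdsWithin_le_nhds (Iio_mem_nhds
      (by positivity : (0 : ℝ) < (L + 1)⁻¹))] with ε hε hε2
    have hε' : 0 < ε := hε
    refine step H hH |M| (abs_nonneg _) hM' ε hε' ?_
    have : ε * (L + 1) < 1 := by
      rw [Set.mem_Iio, ← one_div, lt_div_iff₀ (by positivity)] at hε2
      exact hε2
    nlinarith
  -- removing the error terms in the first order expansion
  set H : ℕ → E → ℝ := fun n x => ‖∇ φ x‖ +
    (1 / ((n : ℝ) + 1) + (Metric.closedBall (0 : E) n)ᶜ.indicator (fun _ => 2 * K) x) with hHdef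
  have hHm : ∀ n, Measurable (H n) := fun n =>
    hgm.norm.add (measurable_const.add
      (measurable_const.indicator Metric.isClosed_closedBall.measurableSet.compl))
  have hK0 : 0 ≤ K := (norm_nonneg _).trans (hK 0)
  have hHb : ∀ n x, ‖H n x‖ ≤ K + (1 + 2 * K) := by
    intro n x
    have h1 : (Metric.closedBall (0 : E) n)ᶜ.indicator (fun _ => 2 * K) x ≤ 2 * K :=
      Set.indicator_le_self' (fun _ _ => by positivity) x
    have h2 : 0 ≤ (Metric.closedBall (0 : E) n)ᶜ.indicator (fun _ => 2 * K) x :=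
      Set.indicator_nonneg (fun _ _ => by positivity) x
    have h3 : 1 / ((n : ℝ) + 1) ≤ 1 := by
      rw [div_le_one (by positivity)]
      linarith [(Nat.cast_nonneg n : (0 : ℝ) ≤ n)]
    have h4 : 0 ≤ 1 / ((n : ℝ) + 1) := by positivity
    rw [Real.norm_of_nonneg (by positivity)]
    have := hK x
    simp only [hHdef]
    linarith
  have hlim : Tendsto (fun n => ∫ x, H n x ^ 2 ∂μ) atTop (𝓝 (∫ x, ‖∇ φ x‖ ^ 2 ∂μ)) := by
    refine tendsto_integral_of_dominated_convergence (fun _ => (K + (1 + 2 * K)) ^ 2)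
      (fun n => ((hHm n).pow_const 2).aestronglyMeasurable) (integrable_const _) ?_ ?_
    · refine fun n => Eventually.of_forall fun x => ?_
      rw [norm_pow]
      exact pow_le_pow_left₀ (norm_nonneg _) (hHb n x) 2
    · refine Eventually.of_forall fun x => ?_
      have h1 : Tendsto (fun n : ℕ => (Metric.closedBall (0 : E) n)ᶜ.indicator (fun _ => 2 * K) x)
          atTop (𝓝 0) := by
        refine tendsto_const_nhds.congr' ?_
        filter_upwards [eventually_ge_atTop ⌈‖x‖⌉₊] with n hn
        rw [Set.indicator_of_notMem]
        simpa using Nat.ceil_le.1 hn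
      have h2 := (tendsto_const_nhds (x := ‖∇ φ x‖)).add
        ((tendsto_one_div_add_atTop_nhds_zero_nat (𝕜 := ℝ)).add h1)
      simpa [hHdef] using h2.pow 2
  refine ge_of_tendsto' ((Real.continuous_sqrt.tendsto _).comp hlim |>.mul_const _) fun n => ?_
  obtain ⟨M, hM⟩ := exists_abs_sub_le_gradient hφ hK (η := 1 / ((n : ℝ) + 1)) (by positivity) n
  exact step2 (H n) (MemLp.of_bound (hHm n).aestronglyMeasurable _ (Eventually.of_forall (hHb n)))
    M hM

/-- The transport-chi-square inequality implies the Poincaré inequality with the same constant. -/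
theorem TransportChiSquareInequality.poincareInequality [IsProbabilityMeasure μ] (hC : 0 ≤ C)
    (h : TransportChiSquareInequality μ C) : PoincareInequality μ C := by
  rintro φ hφ ⟨K, hK⟩
  have hφ2 := memLp_two_of_gradient_bounded (h.memLp_id hC) hφ hK
  refine ⟨hφ2, ?_⟩
  have hφ1 : Integrable φ μ := hφ2.integrable (by norm_num)
  have hφc := hφ.continuous
  -- The linearization needs a bounded perturbation, since `1 + ε f` must be nonnegative; hence `φ`
  -- is truncated.
  set c : ℕ → E → ℝ := fun n x => max (-n) (min n (φ x)) with hc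
  have hcm : ∀ n, Continuous (c n) := fun n => by fun_prop
  have hcn : ∀ n x, |c n x| ≤ n := fun n x => abs_le.2 ⟨le_max_left _ _,
    max_le (by linarith [(Nat.cast_nonneg n : (0 : ℝ) ≤ n)]) (min_le_left _ _)⟩
  have hcφ : ∀ n x, |c n x| ≤ |φ x| := by
    intro n x
    have hn : (0 : ℝ) ≤ n := Nat.cast_nonneg n
    rw [abs_le]
    constructor
    · exact le_max_of_le_right (le_min ((neg_nonpos.2 (abs_nonneg _)).trans hn) (neg_abs_le _))
    · exact max_le ((neg_nonpos.2 hn).trans (abs_nonneg _)) ((min_le_right _ _).trans (le_abs_self _))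
  have hct : ∀ x, Tendsto (fun n => c n x) atTop (𝓝 (φ x)) := by
    intro x
    refine tendsto_const_nhds.congr' ?_
    filter_upwards [eventually_ge_atTop ⌈|φ x|⌉₊] with n hn
    have := abs_le.1 (Nat.ceil_le.1 hn)
    simp only [hc]
    rw [min_eq_right this.2, max_eq_right this.1]
  have hc2 : ∀ n, MemLp (c n) 2 μ := fun n =>
    MemLp.of_bound (hcm n).aestronglyMeasurable n (Eventually.of_forall (hcn n))
  have hc1 : ∀ n, Integrable (c n) μ := fun n => (hc2 n).integrable (by norm_num)
  have t1 : Tendsto (fun n => ∫ x, c n x ∂μ) atTop (𝓝 (∫ x, φ x ∂μ)) :=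
    tendsto_integral_of_dominated_convergence (fun x => |φ x|)
      (fun n => (hcm n).aestronglyMeasurable) hφ1.abs
      (fun n => Eventually.of_forall (hcφ n)) (Eventually.of_forall hct)
  have t2 : Tendsto (fun n => ∫ x, c n x ^ 2 ∂μ) atTop (𝓝 (∫ x, φ x ^ 2 ∂μ)) := by
    refine tendsto_integral_of_dominated_convergence (fun x => φ x ^ 2)
      (fun n => ((hcm n).pow 2).aestronglyMeasurable) hφ2.integrable_sq
      (fun n => Eventually.of_forall fun x => ?_) (Eventually.of_forall fun x => (hct x).pow 2)
    rw [norm_pow, ← sq_abs (φ x)]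
    exact pow_le_pow_left₀ (norm_nonneg _) (hcφ n x) 2
  have t3 : Tendsto (fun n => ∫ x, φ x * c n x ∂μ) atTop (𝓝 (∫ x, φ x ^ 2 ∂μ)) := by
    refine tendsto_integral_of_dominated_convergence (fun x => φ x ^ 2)
      (fun n => (hφc.mul (hcm n)).aestronglyMeasurable) hφ2.integrable_sq
      (fun n => Eventually.of_forall fun x => ?_) (Eventually.of_forall fun x => ?_)
    · rw [norm_mul, ← sq_abs (φ x), sq]
      exact mul_le_mul_of_nonneg_left (hcφ n x) (abs_nonneg _)
    · simpa [sq] using (hct x).const_mul (φ x)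
  set G := ∫ x, ‖∇ φ x‖ ^ 2 ∂μ with hG
  have hG0 : 0 ≤ G := integral_nonneg fun x => by positivity
  have key : ∀ n, ∫ x, φ x * c n x ∂μ - (∫ x, φ x ∂μ) * ∫ x, c n x ∂μ
      ≤ √G * √(C * (∫ x, c n x ^ 2 ∂μ - (∫ x, c n x ∂μ) ^ 2)) := by
    intro n
    set m := ∫ x, c n x ∂μ with hm
    have hk := h.integral_mul_le hC hφ hK (f := fun x => c n x - m) (by fun_prop)
      (L := n + |m|) (fun x => (abs_sub _ _).trans (by gcongr; exact hcn n x))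
      (by rw [integral_sub (hc1 n) (integrable_const _)]; simp [← hm])
    rw [integral_sub_const_sq (hc2 n)] at hk
    refine le_trans (le_of_eq ?_) hk
    have : (fun x => φ x * (c n x - m)) = fun x => φ x * c n x - φ x * m := by
      ext x; ring
    have hi : Integrable (fun x => φ x * c n x) μ := hφ2.integrable_mul (hc2 n)
    rw [this, integral_sub hi (hφ1.mul_const _), integral_mul_const]
  set V := ∫ x, φ x ^ 2 ∂μ - (∫ x, φ x ∂μ) ^ 2 with hV
  have hV0 : 0 ≤ V := by
    rw [hV, ← integral_sub_const_sq hφ2]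
    exact integral_nonneg fun x => sq_nonneg _
  have lim : V ≤ √G * √(C * V) := by
    have l1 := t3.sub (t1.const_mul (∫ x, φ x ∂μ))
    have l2 := ((Real.continuous_sqrt.tendsto _).comp ((t2.sub (t1.pow 2)).const_mul C)).const_mul √G
    rw [hV]
    rw [← sq] at l1
    exact le_of_tendsto_of_tendsto' l1 l2 key
  rw [← Real.sqrt_mul hG0] at lim
  have sq := Real.le_sqrt' (y := G * (C * V)) (x := V)
  rcases hV0.eq_or_lt with h0 | h0
  · rw [← h0]; positivity
  · have := (sq h0).1 lim
    nlinarith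

end Linearization

/-! ### Quantile functions on the line -/

section Quantile

open Classical in
/-- The quantile function of a measure on `ℝ`, with value `0` outside `(0, 1)`. -/
noncomputable def quantile (μ : Measure ℝ) (u : ℝ) : ℝ :=
  if u ∈ Set.Ioo (0 : ℝ) 1 then sInf {x | u ≤ cdf μ x} else 0

variable {μ ν : Measure ℝ} {u : ℝ}

/-- A Galois connection: right continuity of the distribution function shows that the infimum
defining the quantile is attained. -/
theorem quantile_le_iff (hu : u ∈ Set.Ioo (0 : ℝ) 1) {x : ℝ} :
    quantile μ u ≤ x ↔ u ≤ cdf μ x := by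
  rw [quantile, if_pos hu]
  set S := {x | u ≤ cdf μ x} with hS
  have hne : S.Nonempty := by
    obtain ⟨y, hy⟩ := ((tendsto_order.1 (tendsto_cdf_atTop μ)).1 u hu.2).exists
    exact ⟨y, hy.le⟩
  have hbdd : BddBelow S := by
    obtain ⟨y, hy⟩ := ((tendsto_order.1 (tendsto_cdf_atBot μ)).2 u hu.1).exists
    refine ⟨y, fun z hz => ?_⟩
    by_contra! hlt
    exact absurd (hy.trans_le hz) (not_lt.2 (monotone_cdf μ hlt.le))
  constructor
  · intro hx
    have hmem : u ≤ cdf μ (sInf S) := by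
      have hcont : ContinuousWithinAt (cdf μ) (Set.Ioi (sInf S)) (sInf S) :=
        ((cdf μ).right_continuous _).mono Set.Ioi_subset_Ici_self
      refine ge_of_tendsto hcont ?_
      filter_upwards [self_mem_nhdsWithin] with y hy
      obtain ⟨z, hz, hzy⟩ := exists_lt_of_csInf_lt hne hy
      exact le_trans hz (monotone_cdf μ hzy.le)
    exact hmem.trans (monotone_cdf μ hx)
  · exact fun hx => csInf_le hbdd hx

theorem lt_quantile_iff (hu : u ∈ Set.Ioo (0 : ℝ) 1) {x : ℝ} :
    x < quantile μ u ↔ cdf μ x < u := by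
  simpa using (quantile_le_iff hu).not

theorem quantile_mono {v : ℝ} (hu : u ∈ Set.Ioo (0 : ℝ) 1) (hv : v ∈ Set.Ioo (0 : ℝ) 1)
    (huv : u ≤ v) : quantile μ u ≤ quantile μ v :=
  (quantile_le_iff hu).2 (huv.trans ((quantile_le_iff hv).1 le_rfl))

theorem measurable_quantile (μ : Measure ℝ) : Measurable (quantile μ) := by
  refine measurable_of_Iic fun x => ?_
  have : quantile μ ⁻¹' Set.Iic x = (Set.Ioo 0 1 ∩ Set.Iic (cdf μ x)) ∪
      ((Set.Ioo (0 : ℝ) 1)ᶜ ∩ {_u | 0 ≤ x}) := by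
    ext u
    by_cases hu : u ∈ Set.Ioo (0 : ℝ) 1
    · simp only [Set.mem_preimage, Set.mem_Iic, quantile_le_iff hu]
      simp [hu]
    · simp only [Set.mem_preimage, Set.mem_Iic, quantile, if_neg hu]
      simp [hu]
  rw [this]
  exact (measurableSet_Ioo.inter measurableSet_Iic).union
    (measurableSet_Ioo.compl.inter (MeasurableSet.const _))

/-- The quantile function transports the uniform measure on `(0, 1)` to the given measure. -/
theorem map_quantile (μ : Measure ℝ) [IsProbabilityMeasure μ] :
    (volume.restrict (Set.Ioo (0 : ℝ) 1)).map (quantile μ) = μ := by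
  refine (Measure.ext_of_Iic _ _ fun x => ?_).symm
  rw [Measure.map_apply (measurable_quantile μ) measurableSet_Iic,
    Measure.restrict_apply (measurable_quantile μ measurableSet_Iic), ← ofReal_cdf μ x]
  have : quantile μ ⁻¹' Set.Iic x ∩ Set.Ioo 0 1 = Set.Iic (cdf μ x) ∩ Set.Ioo 0 1 := by
    ext u
    refine and_congr_left fun hu => ?_
    simp [quantile_le_iff hu]
  rw [this]
  apply le_antisymm
  · have hsub : Set.Ioo 0 (cdf μ x) ⊆ Set.Iic (cdf μ x) ∩ Set.Ioo 0 1 := fun u hu =>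
      ⟨hu.2.le, hu.1, hu.2.trans_le (cdf_le_one μ x)⟩
    simpa using measure_mono (μ := volume) hsub
  · have hsub : Set.Iic (cdf μ x) ∩ Set.Ioo 0 1 ⊆ Set.Ioc 0 (cdf μ x) := fun u hu =>
      ⟨hu.2.1, hu.1⟩
    simpa using measure_mono (μ := volume) hsub

/-- Away from atoms the distribution function inverts the quantile function. -/
theorem cdf_quantile [IsProbabilityMeasure μ] (hu : u ∈ Set.Ioo (0 : ℝ) 1)
    (h : μ {quantile μ u} = 0) : cdf μ (quantile μ u) = u := by
  refine le_antisymm ?_ ((quantile_le_iff hu).1 le_rfl)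
  -- Without an atom there is no jump, so the value at the quantile is at most the left limit, a
  -- limit of values below `u`.
  have h1 := (cdf μ).measure_singleton (quantile μ u)
  rw [measure_cdf, h, eq_comm, ENNReal.ofReal_eq_zero, sub_nonpos] at h1
  refine h1.trans (le_of_tendsto ((monotone_cdf μ).tendsto_leftLim _) ?_)
  filter_upwards [self_mem_nhdsWithin] with y hy
  exact ((lt_quantile_iff hu).1 hy).le

theorem countable_atoms (μ : Measure ℝ) [SFinite μ] : {x : ℝ | μ {x} ≠ 0}.Countable := by
  simpa [pos_iff_ne_zero] using Measure.countable_meas_level_set_pos (μ := μ) measurable_id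

end Quantile

/-! ### The displacement of the monotone transport -/

section Displacement

open Classical in
/-- The displacement `T(x) - x` of the monotone transport from `μ` to `ν`, truncated at level `R`
and set to zero at the atoms of `μ`. -/
noncomputable def truncatedDisplacement (μ ν : Measure ℝ) (R x : ℝ) : ℝ :=
  if μ {x} ≠ 0 then 0 else if cdf μ x ≤ 0 then -R else if 1 ≤ cdf μ x then R
  else max (-R) (min R (quantile ν (cdf μ x) - x))

variable {μ ν : Measure ℝ} {R u x : ℝ}

theorem measurable_truncatedDisplacement [SFinite μ] :
    Measurable (truncatedDisplacement μ ν R) := by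
  have hF : Measurable (cdf μ) := (monotone_cdf μ).measurable
  refine Measurable.ite (countable_atoms μ).measurableSet measurable_const
    (Measurable.ite (measurableSet_le hF measurable_const) measurable_const
      (Measurable.ite (measurableSet_le measurable_const hF) measurable_const ?_))
  have := (measurable_quantile ν).comp hF
  exact measurable_const.max (measurable_const.min (this.sub measurable_id))

theorem abs_truncatedDisplacement_le (hR : 0 ≤ R) : |truncatedDisplacement μ ν R x| ≤ R := by
  unfold truncatedDisplacement
  split_ifs
  · simpa
  · simp [abs_of_nonneg hR]
  · simp [abs_of_nonneg hR]
  · exact abs_le.2 ⟨le_max_left _ _, max_le (by linarith) (min_le_left _ _)⟩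

/-- Off the atoms `cdf μ` inverts the quantile function, so the displacement at `quantile μ u` is
the truncated difference of quantiles. At an atom many `u` share the same point and no single
displacement fits them all; the value `0` satisfies the bound for each. -/
theorem abs_truncatedDisplacement_quantile_le [IsProbabilityMeasure μ] (hR : 0 ≤ R)
    (hu : u ∈ Set.Ioo (0 : ℝ) 1) :
    |truncatedDisplacement μ ν R (quantile μ u)| ≤ min |quantile ν u - quantile μ u| R := by
  refine le_min ?_ (abs_truncatedDisplacement_le hR)
  unfold truncatedDisplacement
  by_cases h : μ {quantile μ u} = 0
  · rw [cdf_quantile hu h, if_neg (by simpa using h), if_neg (not_le.2 hu.1),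
      if_neg (not_le.2 hu.2)]
    set t := quantile ν u - quantile μ u
    have h1 := neg_abs_le t
    have h2 := le_abs_self t
    have h3 := abs_nonneg t
    rw [abs_le]
    exact ⟨le_max_of_le_right (le_min (by linarith) h1), max_le (by linarith)
      ((min_le_right _ _).trans h2)⟩
  · rw [if_pos h]
    simp

/-- To the right of `quantile μ u` the monotone map is at least `quantile ν u`. Where `cdf μ x = 1`
the value `R` stands for a map equal to `+∞`. -/
theorem min_le_truncatedDisplacement (hu : u ∈ Set.Ioo (0 : ℝ) 1)
    (hx : μ {x} = 0) (h : quantile μ u ≤ x) :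
    min R (quantile ν u - x) ≤ truncatedDisplacement μ ν R x := by
  have hF := (quantile_le_iff hu).1 h
  have h0 : 0 < cdf μ x := hu.1.trans_le hF
  unfold truncatedDisplacement
  rw [if_neg (by simpa using hx), if_neg (not_le.2 h0)]
  split_ifs with h1
  · exact min_le_left _ _
  · refine le_max_of_le_right (min_le_min_left _ (sub_le_sub_right ?_ _))
    exact quantile_mono hu ⟨h0, not_le.1 h1⟩ hF

/-- The mirror image, with `-R` where `cdf μ x = 0` standing for a map equal to `-∞`. -/
theorem truncatedDisplacement_le_max (hu : u ∈ Set.Ioo (0 : ℝ) 1)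
    (hx : μ {x} = 0) (h : x < quantile μ u) :
    truncatedDisplacement μ ν R x ≤ max (-R) (quantile ν u - x) := by
  have hF := (lt_quantile_iff hu).1 h
  have h1 : cdf μ x < 1 := hF.trans hu.2
  unfold truncatedDisplacement
  rw [if_neg (by simpa using hx)]
  split_ifs with h0 h2
  · exact le_max_left _ _
  · exact absurd h1 (not_lt.2 h2)
  · refine max_le_max_left _ ((min_le_right _ _).trans (sub_le_sub_right ?_ _))
    exact quantile_mono ⟨not_le.1 h0, h1⟩ hu hF.le

/-- With `m = min (b - a) R`, the line through `(a, m)` and `(b, 0)` lies below `min R (b - x)`, and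
the triangle under it has area `m * (b - a) / 2 ≥ m ^ 2 / 2`. -/
theorem sq_min_div_two_le_integral {ψ : ℝ → ℝ} {a b R : ℝ} (hR : 0 ≤ R) (hab : a ≤ b)
    (hψ : IntervalIntegrable ψ volume a b)
    (h : ∀ᵐ x, x ∈ Set.Ioo a b → min R (b - x) ≤ ψ x) :
    min (b - a) R ^ 2 / 2 ≤ ∫ x in a..b, ψ x := by
  rcases hab.eq_or_lt with rfl | hlt
  · simp [hR]
  have hd : 0 < b - a := sub_pos.2 hlt
  set m := min (b - a) R with hm
  have hm0 : 0 ≤ m := le_min hd.le hR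
  have hm1 : m ≤ b - a := min_le_left _ _
  have hm2 : m ≤ R := min_le_right _ _
  have hc1 : m / (b - a) ≤ 1 := (div_le_one hd).2 hm1
  have hc0 : 0 ≤ m / (b - a) := by positivity
  have hint : ∫ x in a..b, m / (b - a) * (b - x) = m * (b - a) / 2 := by
    rw [intervalIntegral.integral_const_mul, intervalIntegral.integral_comp_sub_left (fun x => x) b,
      integral_id]
    field_simp
    ring
  calc m ^ 2 / 2 ≤ m * (b - a) / 2 := by nlinarith
    _ = ∫ x in a..b, m / (b - a) * (b - x) := hint.symm
    _ ≤ _ := by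
      refine intervalIntegral.integral_mono_ae_restrict hlt.le
        (Continuous.intervalIntegrable (by fun_prop) _ _) hψ ?_
      rw [← Measure.restrict_congr_set Ioo_ae_eq_Icc, EventuallyLE, ae_restrict_iff' measurableSet_Ioo]
      filter_upwards [h] with x hx hmem
      refine le_trans (le_min ?_ ?_) (hx hmem)
      · calc m / (b - a) * (b - x) ≤ m / (b - a) * (b - a) := by
              gcongr
              exact hmem.1.le
          _ = m := by field_simp
          _ ≤ R := hm2
      · exact mul_le_of_le_one_left (by linarith [hmem.2]) hc1

theorem sq_min_div_two_le_integral_truncatedDisplacement [SFinite μ] (hR : 0 ≤ R)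
    (hu : u ∈ Set.Ioo (0 : ℝ) 1) :
    min |quantile ν u - quantile μ u| R ^ 2 / 2
      ≤ ∫ x in quantile μ u..quantile ν u, truncatedDisplacement μ ν R x := by
  have hna : ∀ᵐ x : ℝ, μ {x} = 0 := by
    filter_upwards [(countable_atoms μ).ae_notMem volume] with x hx
    simpa using hx
  have hii : ∀ a b, IntervalIntegrable (truncatedDisplacement μ ν R) volume a b := fun a b =>
    (intervalIntegrable_const (c := R)).mono_fun
      measurable_truncatedDisplacement.aestronglyMeasurable
      (Eventually.of_forall fun x => by
        exact (abs_truncatedDisplacement_le hR).trans (le_abs_self R))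
  rcases le_total (quantile μ u) (quantile ν u) with h | h
  · rw [abs_of_nonneg (sub_nonneg.2 h)]
    refine sq_min_div_two_le_integral hR h (hii _ _) ?_
    filter_upwards [hna] with x hx hmem
    exact min_le_truncatedDisplacement hu hx hmem.1.le
  · rw [abs_of_nonpos (sub_nonpos.2 h)]
    -- The reflection `x ↦ -x`, with `ψ` replaced by `-ψ(-x)`, reduces reversed endpoints to the
    -- ordered case.
    have hna' : ∀ᵐ x : ℝ, μ {-x} = 0 :=
      (Measure.measurePreserving_neg (volume : Measure ℝ)).quasiMeasurePreserving.ae hna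
    have key := sq_min_div_two_le_integral (ψ := fun x => -truncatedDisplacement μ ν R (-x))
      (a := -quantile μ u) (b := -quantile ν u) hR (neg_le_neg h)
      (by
        have := ((hii (quantile μ u) (quantile ν u)).comp_mul_left (c := -1)).neg
        simpa [neg_one_mul, div_neg, Pi.neg_def] using this) ?_
    · rw [intervalIntegral.integral_neg, intervalIntegral.integral_comp_neg, neg_neg, neg_neg,
        ← intervalIntegral.integral_symm] at key
      rwa [show -(quantile ν u - quantile μ u) = -quantile ν u - -quantile μ u by ring]
    · filter_upwards [hna'] with x hx hmem
      have h1 := truncatedDisplacement_le_max (ν := ν) (R := R) hu hx (by linarith [hmem.1])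
      rcases le_max_iff.1 h1 with h2 | h2
      · exact (min_le_left _ _).trans (by linarith)
      · exact (min_le_right _ _).trans (by linarith)

end Displacement

/-! ### Poincaré inequality for primitives of bounded measurable functions -/

section Extension

variable {μ : Measure ℝ} {C : ℝ}

theorem PoincareInequality.of_continuous_deriv (h : PoincareInequality μ C) {ψ : ℝ → ℝ}
    (hψ : Continuous ψ) {R : ℝ} (hR : ∀ x, |ψ x| ≤ R) :
    MemLp (fun x => ∫ t in (0 : ℝ)..x, ψ t) 2 μ ∧
      ∫ x, (∫ t in (0 : ℝ)..x, ψ t) ^ 2 ∂μ - (∫ x, (∫ t in (0 : ℝ)..x, ψ t) ∂μ) ^ 2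
        ≤ C * ∫ x, ψ x ^ 2 ∂μ := by
  have hd : deriv (fun x => ∫ t in (0 : ℝ)..x, ψ t) = ψ := by
    ext x
    exact hψ.deriv_integral ψ 0 x
  have hdiff : Differentiable ℝ (fun x => ∫ t in (0 : ℝ)..x, ψ t) := fun x =>
    (hψ.integral_hasStrictDerivAt 0 x).hasDerivAt.differentiableAt
  have hgrad : ∀ x, ∇ (fun x => ∫ t in (0 : ℝ)..x, ψ t) x = ψ x := fun x => by
    rw [gradient_eq_deriv', hd]
  have := h (fun x => ∫ t in (0 : ℝ)..x, ψ t) (contDiff_one_iff_deriv.2 ⟨hdiff, by rwa [hd]⟩)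
    ⟨R, fun x => by rw [hgrad]; exact hR x⟩
  simpa only [hgrad, Real.norm_eq_abs, sq_abs] using this

/-- A bounded measurable function is the almost everywhere limit of a sequence of continuous
functions with the same bound. -/
theorem exists_continuous_seq_tendsto_ae (ρ : Measure ℝ) [SFinite ρ] {ψ : ℝ → ℝ}
    (hψ : Measurable ψ) {R : ℝ} (hR : ∀ x, |ψ x| ≤ R) :
    ∃ f : ℕ → ℝ → ℝ, (∀ n, Continuous (f n)) ∧ (∀ n x, |f n x| ≤ R) ∧
      ∀ᵐ x ∂ρ, Tendsto (fun n => f n x) atTop (𝓝 (ψ x)) := by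
  have hR0 : 0 ≤ R := (abs_nonneg _).trans (hR 0)
  -- A finite measure with the same null sets as `ρ` puts `ψ` in `L¹`, where continuous functions
  -- are dense.
  have hmem : MemLp ψ 1 ρ.toFinite :=
    MemLp.of_bound hψ.aestronglyMeasurable R (Eventually.of_forall hR)
  have hpos : ∀ n : ℕ, ((n : ℝ≥0∞) + 1)⁻¹ ≠ 0 := fun n => by simp
  choose g hg _ using fun n : ℕ =>
    hmem.exists_boundedContinuous_eLpNorm_sub_le ENNReal.one_ne_top (hpos n)
  have hlim : Tendsto (fun n => eLpNorm (⇑(g n) - ψ) 1 ρ.toFinite) atTop (𝓝 0) := by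
    have h0 : Tendsto (fun n : ℕ => ((n : ℝ≥0∞) + 1)⁻¹) atTop (𝓝 0) := by
      have := ENNReal.tendsto_inv_nat_nhds_zero.comp (tendsto_add_atTop_nat 1)
      simpa [Function.comp_def] using this
    refine tendsto_of_tendsto_of_tendsto_of_le_of_le tendsto_const_nhds h0 (fun _ => bot_le)
      fun n => ?_
    rw [eLpNorm_sub_comm]
    exact hg n
  obtain ⟨ns, -, hns⟩ := (tendstoInMeasure_of_tendsto_eLpNorm one_ne_zero
    (fun n => (g n).continuous.aestronglyMeasurable) hψ.aestronglyMeasurable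
    hlim).exists_seq_tendsto_ae
  refine ⟨fun n x => max (-R) (min R (g (ns n) x)), fun n => by fun_prop, fun n x => ?_, ?_⟩
  · exact abs_le.2 ⟨le_max_left _ _, max_le (by linarith) (min_le_left _ _)⟩
  · rw [← ae_toFinite]
    filter_upwards [hns] with x hx
    have h1 := (tendsto_const_nhds (x := -R)).max ((tendsto_const_nhds (x := R)).min hx)
    have h2 := abs_le.1 (hR x)
    rwa [min_eq_right h2.2, max_eq_right h2.1] at h1

theorem abs_integral_le_of_abs_le {ψ : ℝ → ℝ} {R : ℝ} (hR : ∀ x, |ψ x| ≤ R) (x : ℝ) :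
    |∫ t in (0 : ℝ)..x, ψ t| ≤ R * |x| := by
  have := intervalIntegral.norm_integral_le_of_norm_le_const (a := 0) (b := x) (f := ψ) (C := R)
    fun t _ => hR t
  simpa using this

/-- The Poincaré inequality on `ℝ` extends to Lipschitz functions, given by a bounded measurable
derivative. -/
theorem PoincareInequality.of_measurable_deriv [IsProbabilityMeasure μ]
    (h : PoincareInequality μ C) {ψ : ℝ → ℝ} (hψ : Measurable ψ) {R : ℝ} (hR : ∀ x, |ψ x| ≤ R) :
    MemLp (fun x => ∫ t in (0 : ℝ)..x, ψ t) 2 μ ∧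
      ∫ x, (∫ t in (0 : ℝ)..x, ψ t) ^ 2 ∂μ - (∫ x, (∫ t in (0 : ℝ)..x, ψ t) ∂μ) ^ 2
        ≤ C * ∫ x, ψ x ^ 2 ∂μ := by
  -- The test function `φ(x) = x` yields the second moment, which makes `R * |x|` a dominating
  -- function below.
  have hid : MemLp (fun x : ℝ => x) 2 μ := by
    have := (h.of_continuous_deriv (ψ := fun _ => 1) continuous_const (R := 1) (by simp)).1
    simpa using this
  -- Lebesgue-a.e. convergence handles the primitives, and `μ`-a.e. convergence handles `∫ ψ² dμ`.
  obtain ⟨f, hfc, hfR, hft⟩ := exists_continuous_seq_tendsto_ae (μ + volume) hψ hR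
  rw [ae_add_measure_iff] at hft
  set Φ : ℕ → ℝ → ℝ := fun n x => ∫ t in (0 : ℝ)..x, f n t with hΦ
  set φ : ℝ → ℝ := fun x => ∫ t in (0 : ℝ)..x, ψ t with hφ
  have hΦc : ∀ n, Continuous (Φ n) := fun n =>
    intervalIntegral.continuous_primitive (fun a b => (hfc n).intervalIntegrable a b) 0
  have hφc : Continuous φ := intervalIntegral.continuous_primitive (fun a b =>
    (intervalIntegrable_const (c := R)).mono_fun hψ.aestronglyMeasurable
      (Eventually.of_forall fun x => (hR x).trans (le_abs_self R))) 0
  have hΦt : ∀ x, Tendsto (fun n => Φ n x) atTop (𝓝 (φ x)) := fun x =>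
    intervalIntegral.tendsto_integral_filter_of_dominated_convergence (fun _ => R)
      (Eventually.of_forall fun n => (hfc n).aestronglyMeasurable)
      (Eventually.of_forall fun n => Eventually.of_forall fun t _ => hfR n t)
      intervalIntegrable_const (by filter_upwards [hft.2] with t ht _ using ht)
  have hb : MemLp (fun x => R * |x|) 2 μ := hid.abs.const_mul R
  have hΦb : ∀ n x, |Φ n x| ≤ R * |x| := fun n x => abs_integral_le_of_abs_le (hfR n) x
  refine ⟨hb.mono' hφc.aestronglyMeasurable
    (Eventually.of_forall (abs_integral_le_of_abs_le hR)), ?_⟩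
  have t1 : Tendsto (fun n => ∫ x, Φ n x ∂μ) atTop (𝓝 (∫ x, φ x ∂μ)) :=
    tendsto_integral_of_dominated_convergence _ (fun n => (hΦc n).aestronglyMeasurable)
      (hb.integrable (by norm_num)) (fun n => Eventually.of_forall (hΦb n))
      (Eventually.of_forall hΦt)
  have t2 : Tendsto (fun n => ∫ x, Φ n x ^ 2 ∂μ) atTop (𝓝 (∫ x, φ x ^ 2 ∂μ)) := by
    refine tendsto_integral_of_dominated_convergence _
      (fun n => ((hΦc n).pow 2).aestronglyMeasurable) hb.integrable_sq
      (fun n => Eventually.of_forall fun x => ?_) (Eventually.of_forall fun x => (hΦt x).pow 2)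
    rw [norm_pow]
    exact pow_le_pow_left₀ (norm_nonneg _) (hΦb n x) 2
  have t3 : Tendsto (fun n => ∫ x, f n x ^ 2 ∂μ) atTop (𝓝 (∫ x, ψ x ^ 2 ∂μ)) := by
    refine tendsto_integral_of_dominated_convergence (fun _ => R ^ 2)
      (fun n => ((hfc n).pow 2).aestronglyMeasurable) (integrable_const _)
      (fun n => Eventually.of_forall fun x => ?_) ?_
    · rw [norm_pow]
      exact pow_le_pow_left₀ (norm_nonneg _) (hfR n x) 2
    · filter_upwards [hft.1] with x hx using hx.pow 2
  exact le_of_tendsto_of_tendsto' (t2.sub (t1.pow 2)) (t3.const_mul C) fun n =>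
    (h.of_continuous_deriv (hfc n) (hfR n)).2

end Extension

/-! ### From Poincaré to transport by the monotone coupling -/

section Transport

/-- Differences of integrals are controlled by the standard deviation and the chi-square
pseudo-distance. -/
theorem integral_sub_integral_le_chiSquare {E : Type*} [MeasurableSpace E] {μ ν : Measure E}
    [IsProbabilityMeasure μ] [IsProbabilityMeasure ν] (hχ : chiSquareSq ν μ ≠ ∞) {φ : E → ℝ}
    (hφ : MemLp φ 2 μ) :
    Integrable φ ν ∧ ∫ x, φ x ∂ν - ∫ x, φ x ∂μ
      ≤ √(∫ x, φ x ^ 2 ∂μ - (∫ x, φ x ∂μ) ^ 2) * √(chiSquareSq ν μ).toReal := by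
  have hac : ν ≪ μ := by
    by_contra hcon
    exact hχ (if_neg hcon)
  rw [chiSquareSq, if_pos hac] at hχ ⊢
  set g : E → ℝ := fun x => (ν.rnDeriv μ x).toReal with hg
  have hgm : Measurable g := (Measure.measurable_rnDeriv ν μ).ennreal_toReal
  have henorm : ∀ x, ‖g x - 1‖ₑ ^ 2 = ENNReal.ofReal ((g x - 1) ^ 2) := fun x => by
    rw [← ofReal_norm, ← ENNReal.ofReal_pow (norm_nonneg _), Real.norm_eq_abs, sq_abs]
  have hg2 : MemLp (fun x => g x - 1) 2 μ := by
    refine memLp_two_of_lintegral_enorm_sq_ne_top (by fun_prop) ?_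
    simpa only [henorm] using hχ
  have hgχ : (∫⁻ x, ENNReal.ofReal ((g x - 1) ^ 2) ∂μ).toReal = ∫ x, (g x - 1) ^ 2 ∂μ := by
    have := toReal_lintegral_enorm_sq hg2.1
    simpa only [henorm, Real.norm_eq_abs, sq_abs] using this
  have hφ1 : Integrable φ μ := hφ.integrable (by norm_num)
  have hφg : Integrable (fun x => φ x * (g x - 1)) μ := hφ.integrable_mul hg2
  have hgφ : Integrable (fun x => g x • φ x) μ :=
    (hφg.add hφ1).congr (Eventually.of_forall fun x => by simp; ring)
  refine ⟨(integrable_rnDeriv_smul_iff hac).1 hgφ, ?_⟩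
  have e1 : ∫ x, φ x ∂ν = ∫ x, g x • φ x ∂μ := (integral_rnDeriv_smul hac).symm
  have hg0 : ∫ x, (g x - 1) ∂μ = 0 := by
    have hgi : Integrable g μ := Measure.integrable_toReal_rnDeriv
    rw [integral_sub hgi (integrable_const _), Measure.integral_toReal_rnDeriv hac]
    simp
  set m := ∫ x, φ x ∂μ with hm
  have hφm : MemLp (fun x => φ x - m) 2 μ := hφ.sub (memLp_const m)
  -- Since `g - 1` has mean zero, `φ` may be centred, so Cauchy–Schwarz produces its variance.
  have e2 : ∫ x, φ x ∂ν - m = ∫ x, (φ x - m) * (g x - 1) ∂μ := by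
    have : (fun x => (φ x - m) * (g x - 1)) = fun x => φ x * (g x - 1) - m * (g x - 1) := by
      ext x; ring
    rw [this, integral_sub hφg ((hg2.integrable (by norm_num)).const_mul m), integral_const_mul,
      hg0, mul_zero, sub_zero, e1, hm, ← integral_sub hgφ hφ1]
    congr 1 with x
    simp; ring
  rw [e2, hgχ, ← integral_sub_const_sq hφ]
  exact integral_mul_le_sqrt_mul_sqrt hφm hg2

variable {μ : Measure ℝ} {C : ℝ}

/-- The truncated cost of the monotone coupling under a Poincaré inequality. -/
theorem PoincareInequality.integral_sq_min_quantile_le [IsProbabilityMeasure μ] (hC : 0 ≤ C)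
    (h : PoincareInequality μ C) {ν : Measure ℝ} [IsProbabilityMeasure ν]
    (hχ : chiSquareSq ν μ ≠ ∞) {R : ℝ} (hR : 0 ≤ R) :
    ∫ u in Set.Ioo (0 : ℝ) 1, min |quantile ν u - quantile μ u| R ^ 2
      ≤ 4 * C * (chiSquareSq ν μ).toReal := by
  set ψ := truncatedDisplacement μ ν R with hψ
  have hψm : Measurable ψ := measurable_truncatedDisplacement
  have hψR : ∀ x, |ψ x| ≤ R := fun x => abs_truncatedDisplacement_le hR
  obtain ⟨hφ2, hφP⟩ := h.of_measurable_deriv hψm hψR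
  set φ : ℝ → ℝ := fun x => ∫ t in (0 : ℝ)..x, ψ t with hφ
  have hii : ∀ a b, IntervalIntegrable ψ volume a b := fun a b =>
    (intervalIntegrable_const (c := R)).mono_fun hψm.aestronglyMeasurable
      (Eventually.of_forall fun x => (hψR x).trans (le_abs_self R))
  have hφc : Continuous φ := intervalIntegral.continuous_primitive hii 0
  obtain ⟨hφν, hdiff⟩ := integral_sub_integral_le_chiSquare hχ hφ2
  have hφμ : Integrable φ μ := hφ2.integrable (by norm_num)
  set U : Measure ℝ := volume.restrict (Set.Ioo (0 : ℝ) 1) with hU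
  have hUμ : U.map (quantile μ) = μ := map_quantile μ
  have hUν : U.map (quantile ν) = ν := map_quantile ν
  have hqμ := measurable_quantile μ
  have hqν := measurable_quantile ν
  have haeU : ∀ᵐ u ∂U, u ∈ Set.Ioo (0 : ℝ) 1 := ae_restrict_mem measurableSet_Ioo
  have : IsFiniteMeasure U := by
    constructor
    simp [hU]
  set c : ℝ → ℝ := fun u => min |quantile ν u - quantile μ u| R with hc
  have hcm : Measurable c := ((hqν.sub hqμ).abs).min measurable_const
  have hc0 : ∀ u, 0 ≤ c u := fun u => le_min (abs_nonneg _) hR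
  have hci : Integrable (fun u => c u ^ 2) U := by
    refine Integrable.of_bound (hcm.pow_const 2).aestronglyMeasurable (R ^ 2)
      (Eventually.of_forall fun u => ?_)
    rw [Real.norm_of_nonneg (sq_nonneg _)]
    exact pow_le_pow_left₀ (hc0 u) (min_le_right _ _) 2
  have iμ : Integrable (fun u => φ (quantile μ u)) U := by
    rw [← hUμ] at hφμ
    exact hφμ.comp_measurable hqμ
  have iν : Integrable (fun u => φ (quantile ν u)) U := by
    rw [← hUν] at hφν
    exact hφν.comp_measurable hqν
  have eμ : ∫ u, φ (quantile μ u) ∂U = ∫ x, φ x ∂μ := by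
    conv_rhs => rw [← hUμ]
    rw [integral_map hqμ.aemeasurable hφc.aestronglyMeasurable]
  have eν : ∫ u, φ (quantile ν u) ∂U = ∫ x, φ x ∂ν := by
    conv_rhs => rw [← hUν]
    rw [integral_map hqν.aemeasurable hφc.aestronglyMeasurable]
  have eψ : ∫ u, ψ (quantile μ u) ^ 2 ∂U = ∫ x, ψ x ^ 2 ∂μ := by
    conv_rhs => rw [← hUμ]
    rw [integral_map hqμ.aemeasurable (hψm.pow_const 2).aestronglyMeasurable]
  set I := ∫ u, c u ^ 2 ∂U with hI
  have hI0 : 0 ≤ I := integral_nonneg fun u => sq_nonneg _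
  have b1 : ∫ x, ψ x ^ 2 ∂μ ≤ I := by
    rw [← eψ]
    refine integral_mono_ae ?_ hci ?_
    · refine Integrable.of_bound ((hψm.comp hqμ).pow_const 2).aestronglyMeasurable (R ^ 2)
        (Eventually.of_forall fun u => ?_)
      rw [norm_pow]
      exact pow_le_pow_left₀ (norm_nonneg _) (hψR _) 2
    · filter_upwards [haeU] with u hu
      rw [← sq_abs]
      exact pow_le_pow_left₀ (abs_nonneg _) (abs_truncatedDisplacement_quantile_le hR hu) 2
  have b2 : I / 2 ≤ ∫ x, φ x ∂ν - ∫ x, φ x ∂μ := by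
    rw [← eμ, ← eν, ← integral_sub iν iμ, hI, ← integral_div]
    refine integral_mono_ae (hci.div_const 2) (iν.sub iμ) ?_
    filter_upwards [haeU] with u hu
    simp only [hφ]
    rw [intervalIntegral.integral_interval_sub_left (hii _ _) (hii _ _)]
    exact sq_min_div_two_le_integral_truncatedDisplacement hR hu
  set X := (chiSquareSq ν μ).toReal with hX
  have hX0 : 0 ≤ X := ENNReal.toReal_nonneg
  have b3 : I / 2 ≤ √(C * I * X) := by
    refine (b2.trans hdiff).trans ?_
    rw [Real.sqrt_mul (by positivity)]
    gcongr
    exact hφP.trans (mul_le_mul_of_nonneg_left b1 hC)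
  rcases hI0.eq_or_lt with h0 | h0
  · rw [← h0]; positivity
  -- Squaring gives `I ^ 2 / 4 ≤ C * I * X`; dividing by `I > 0` yields the constant `4`.
  · have := (Real.le_sqrt' (by positivity)).1 b3
    nlinarith

/-- On the real line the Poincaré inequality implies the transport-chi-square inequality. -/
theorem PoincareInequality.transportChiSquareInequality [IsProbabilityMeasure μ] (hC : 0 ≤ C)
    (h : PoincareInequality μ C) : TransportChiSquareInequality μ (4 * C) := by
  intro ν hν hχ'
  have hχ := chiSquare_ne_top_iff.1 hχ'
  have hqμ := measurable_quantile μ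
  have hqν := measurable_quantile ν
  set U : Measure ℝ := volume.restrict (Set.Ioo (0 : ℝ) 1) with hU
  have hUp : IsProbabilityMeasure U := ⟨by simp [hU]⟩
  have hcost : ∫⁻ u, ‖quantile μ u - quantile ν u‖ₑ ^ 2 ∂U
      ≤ ENNReal.ofReal (4 * C) * chiSquareSq ν μ := by
    -- The truncated bound is uniform in the level, so monotone convergence removes the truncation.
    set f : ℕ → ℝ → ℝ≥0∞ := fun n u =>
      ENNReal.ofReal (min |quantile ν u - quantile μ u| n ^ 2) with hf
    have hfm : ∀ n, Measurable (f n) := fun n =>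
      ((((hqν.sub hqμ).abs).min measurable_const).pow_const 2).ennreal_ofReal
    have hlim : Tendsto (fun n => ∫⁻ u, f n u ∂U) atTop
        (𝓝 (∫⁻ u, ‖quantile μ u - quantile ν u‖ₑ ^ 2 ∂U)) := by
      refine lintegral_tendsto_of_tendsto_of_monotone (fun n => (hfm n).aemeasurable)
        (Eventually.of_forall fun u m n hmn => ?_) (Eventually.of_forall fun u => ?_)
      · simp only [hf]
        gcongr
      · refine tendsto_const_nhds.congr' ?_
        filter_upwards [eventually_ge_atTop ⌈|quantile ν u - quantile μ u|⌉₊] with n hn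
        simp only [hf]
        rw [min_eq_left (Nat.ceil_le.1 hn), ← ofReal_norm, ← ENNReal.ofReal_pow (norm_nonneg _),
          norm_sub_rev, Real.norm_eq_abs]
    refine le_of_tendsto' hlim fun n => ?_
    have hb := h.integral_sq_min_quantile_le hC hχ (R := n) (Nat.cast_nonneg n)
    have hi : Integrable (fun u => min |quantile ν u - quantile μ u| n ^ 2) U := by
      refine Integrable.of_bound
        ((((hqν.sub hqμ).abs).min measurable_const).pow_const 2).aestronglyMeasurable
        ((n : ℝ) ^ 2) (Eventually.of_forall fun u => ?_)
      rw [Real.norm_of_nonneg (sq_nonneg _)]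
      exact pow_le_pow_left₀ (le_min (abs_nonneg _) (Nat.cast_nonneg n)) (min_le_right _ _) 2
    rw [← ofReal_integral_eq_lintegral_ofReal hi (Eventually.of_forall fun u => sq_nonneg _)]
    refine (ENNReal.ofReal_le_ofReal hb).trans_eq ?_
    rw [ENNReal.ofReal_mul (by positivity), ENNReal.ofReal_toReal hχ]
  have hpair : Measurable fun u => (quantile μ u, quantile ν u) := hqμ.prodMk hqν
  have hmem : U.map (fun u => (quantile μ u, quantile ν u)) ∈ couplings μ ν := by
    refine ⟨Measure.isProbabilityMeasure_map hpair.aemeasurable, ?_, ?_⟩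
    · rw [Measure.map_map measurable_fst hpair]
      exact map_quantile μ
    · rw [Measure.map_map measurable_snd hpair]
      exact map_quantile ν
  have hinf : (⨅ γ ∈ couplings μ ν, ∫⁻ p : ℝ × ℝ, ‖p.1 - p.2‖ₑ ^ 2 ∂γ)
      ≤ ENNReal.ofReal (4 * C) * chiSquareSq ν μ := by
    refine (iInf₂_le _ hmem).trans ?_
    rwa [lintegral_map (by fun_prop) hpair]
  calc wasserstein₂ μ ν ≤ (ENNReal.ofReal (4 * C) * chiSquareSq ν μ) ^ (1 / 2 : ℝ) :=
        ENNReal.rpow_le_rpow hinf (by norm_num)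
    _ = _ := by
      rw [ENNReal.mul_rpow_of_nonneg _ _ (by norm_num), chiSquare, Real.sqrt_eq_rpow,
        ENNReal.ofReal_rpow_of_nonneg (by positivity) (by norm_num)]

theorem TransportChiSquareInequality.mono {E : Type*} [NormedAddCommGroup E] [MeasurableSpace E]
    {μ : Measure E} {C D : ℝ} (h : TransportChiSquareInequality μ C) (hCD : C ≤ D) :
    TransportChiSquareInequality μ D := fun ν hν hχ =>
  (h ν hν hχ).trans (by gcongr)

end Transport

theorem theorem1 :
    (∀ d : ℕ, 1 ≤ d → ∀ μ : Measure (EuclideanSpace ℝ (Fin d)), IsProbabilityMeasure μ →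
      ∀ C : ℝ, 0 ≤ C → TransportChiSquareInequality μ C → PoincareInequality μ C) ∧
    (∀ μ : Measure ℝ, IsProbabilityMeasure μ →
      (∀ C : ℝ, 0 ≤ C → TransportChiSquareInequality μ C → PoincareInequality μ C) ∧
      (∀ C : ℝ, 0 ≤ C → PoincareInequality μ C → TransportChiSquareInequality μ (32 * C)) ∧
      ((∃ C : ℝ, 0 ≤ C ∧ TransportChiSquareInequality μ C) ↔
        ∃ C : ℝ, 0 ≤ C ∧ PoincareInequality μ C)) := by
  refine ⟨fun d _ μ _ C hC h => h.poincareInequality hC, fun μ _ =>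
    ⟨fun C hC h => h.poincareInequality hC,
      -- The monotone coupling already gives `4 * C`, which is at most `32 * C`.
      fun C hC h => (h.transportChiSquareInequality hC).mono (by linarith), ?_, ?_⟩⟩
  · rintro ⟨C, hC, h⟩
    exact ⟨C, hC, h.poincareInequality hC⟩
  · rintro ⟨C, hC, h⟩
    exact ⟨4 * C, by positivity, h.transportChiSquareInequality hC⟩
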